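/- **Theorem.** A *weight sequence* is a sequence $M=(M_k)_{k\ge 0}$ of positive reals with $M_0=1$ whose quotients $\mu_k=M_k/M_{k-1}$, $k\ge1$, are increasing and tend to $\infty$; put $\omega_M(t)=\sup_{k\in\mathbb N}\log(t^k/M_k)$ for $t\ge0$. A *weight matrix* is a family $\mathfrak M=(M^{(x)})_{x>0}$ of weight sequences such that $M^{(x)}_k\le M^{(y)}_k$ for all $k$ whenever $x\le y$, and $(M^{(x)}_j/j!)^{1/j}\to\infty$ as $j\to\infty$ for every $x>0$. Let $\mathfrak M$ be a weight matrix. Let $$\Lambda^{(\mathfrak M)}=\Big\{a\in\mathbb C^{\mathbb N}:\ \|a\|_{r,x}:=\sup_{k\in\mathbb N}\frac{|a_k|}{r^kM^{(x)}_k}<\infty\ \text{ for all } r,x>0\Big\}$$ with the locally convex topology given by the seminorms $\|\cdot\|_{r,x}$, $r,x>0$, let $e_j$ be the $j$-th unit vector, and let $(\Lambda^{(\mathfrak M)})'$ be the dual with the strong topology (uniform convergence on bounded sets). For $k=1,2,\dots$ let $A_k$ be the space of entire functions $f$ with $$\|f\|_{A_k}:=\sup_{z\in\mathbb C}|f(z)|\,e^{-\omega_{M^{(1/k)}}(k|z|)}<\infty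 ,$$ normed by $\|\cdot\|_{A_k}$, and let $\mathcal A_{\Omega_{\mathfrak M}}=\bigcup_{k\ge1}A_k$ with the locally convex inductive limit topology, i.e. the finest locally convex topology for which all inclusions $A_k\to\mathcal A_{\Omega_{\mathfrak M}}$ are continuous. Then for every $T\in(\Lambda^{(\mathfrak M)})'$ the series $\sum_{j\ge0}T(e_j)z^j$ converges for all $z\in\mathbb C$, its sum $\widetilde S(T)(z)$ is an element of $\mathcal A_{\Omega_{\mathfrak M}}$, and $$\widetilde S:(\Lambda^{(\mathfrak M)})'\to\mathcal A_{\Omega_{\mathfrak M}},\qquad \widetilde S(T)(z)=\sum_{j\ge0}T(e_j)z^j,$$ is an isomorphism of locally convex spaces, i.e. a linear homeomorphism. -/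

import Mathlib

open Filter Topology

namespace WeightMatrixDual

/-! ### Weights -/

/-- A weight sequence: positive reals `M 0 = 1, M 1, M 2, …` whose quotients
`μ_(k+1) = M (k+1) / M k` increase to infinity. -/
structure WeightSequence where
  toFun : ℕ → ℝ
  pos : ∀ k, 0 < toFun k
  map_zero : toFun 0 = 1
  quotient_mono : Monotone fun k => toFun (k + 1) / toFun k
  quotient_tendsto : Tendsto (fun k => toFun (k + 1) / toFun k) atTop atTop

instance : CoeFun WeightSequence fun _ => ℕ → ℝ := ⟨WeightSequence.toFun⟩

/-- A weight matrix `(M^(x))_{x > 0}`: pointwise increasing in `x`, and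
`(M^(x)_j / j!)^(1/j) → ∞` for every `x > 0`. -/
structure WeightMatrix where
  seq : Set.Ioi (0 : ℝ) → WeightSequence
  mono : ∀ x y, x ≤ y → ∀ k, seq x k ≤ seq y k
  root_tendsto : ∀ x,
    Tendsto (fun j : ℕ => (seq x j / (j.factorial : ℝ)) ^ (1 / (j : ℝ))) atTop atTop

/-- The associated function `ω_M(t) = sup_k log (t^k / M_k)`, for `t ≥ 0`.
(For `t = 0` the terms with `k ≥ 1` have the value `0` here instead of `-∞`; as the term `k = 0`
is `0`, the supremum is `0` either way.) -/
noncomputable def assocWeight (M : WeightSequence) (t : ℝ) : ℝ :=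
  ⨆ k : ℕ, Real.log (t ^ k / M k)

/-- The supremum defining the associated function is finite. -/
theorem bddAbove_assocWeight (M : WeightSequence) {t : ℝ} (ht : 0 ≤ t) :
    BddAbove (Set.range fun k : ℕ => Real.log (t ^ k / M k)) := by
  obtain ⟨K, hK⟩ := eventually_atTop.1 (M.quotient_tendsto.eventually_ge_atTop t)
  have step : ∀ k, K ≤ k → t ^ k / M k ≤ t ^ K / M K := by
    intro k hk
    induction k, hk using Nat.le_induction with
    | base => exact le_rfl
    | succ k hk ih =>
      refine le_trans ?_ ih
      have h1 := (le_div_iff₀ (M.pos k)).1 (hK k hk)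
      rw [div_le_div_iff₀ (M.pos _) (M.pos _), pow_succ]
      have := mul_le_mul_of_nonneg_left h1 (pow_nonneg ht k)
      nlinarith
  refine Filter.IsBoundedUnder.bddAbove_range ⟨t ^ K / M K, ?_⟩
  rw [eventually_map]
  filter_upwards [eventually_ge_atTop K] with k hk
  exact (Real.log_le_self (div_nonneg (pow_nonneg ht k) (M.pos k).le)).trans (step k hk)

/-! ### Weighted suprema -/

section WeightedSup

variable {ι : Type*}

/-- The functions `f : ι → ℂ` with `sup_i |f i| / w i < ∞`. -/
def weightedBounded (w : ι → ℝ) (hw : ∀ i, 0 < w i) : Submodule ℂ (ι → ℂ) where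
  carrier := {f | BddAbove (Set.range fun i => ‖f i‖ / w i)}
  zero_mem' := ⟨0, by rintro _ ⟨i, rfl⟩; simp⟩
  add_mem' := by
    rintro f g ⟨a, ha⟩ ⟨b, hb⟩
    refine ⟨a + b, ?_⟩
    rintro _ ⟨i, rfl⟩
    have h1 := ha ⟨i, rfl⟩
    have h2 := hb ⟨i, rfl⟩
    have h3 : ‖(f + g) i‖ / w i ≤ ‖f i‖ / w i + ‖g i‖ / w i := by
      rw [← add_div]
      exact div_le_div_of_nonneg_right (norm_add_le _ _) (hw i).le
    exact h3.trans (add_le_add h1 h2)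
  smul_mem' := by
    rintro c f ⟨a, ha⟩
    refine ⟨‖c‖ * a, ?_⟩
    rintro _ ⟨i, rfl⟩
    have h1 := ha ⟨i, rfl⟩
    simp only [Pi.smul_apply, smul_eq_mul, norm_mul, mul_div_assoc]
    exact mul_le_mul_of_nonneg_left h1 (norm_nonneg c)

/-- `sup_i |f i| / w i`. -/
noncomputable def weightedSup (w : ι → ℝ) (f : ι → ℂ) : ℝ := ⨆ i, ‖f i‖ / w i

theorem weightedSup_zero (w : ι → ℝ) : weightedSup w 0 = 0 := by
  simp [weightedSup]

theorem weightedSup_neg (w : ι → ℝ) (f : ι → ℂ) : weightedSup w (-f) = weightedSup w f := by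
  simp [weightedSup]

theorem weightedSup_smul (w : ι → ℝ) (c : ℂ) (f : ι → ℂ) :
    weightedSup w (c • f) = ‖c‖ * weightedSup w f := by
  simp only [weightedSup, Pi.smul_apply, smul_eq_mul, norm_mul, mul_div_assoc]
  exact (Real.mul_iSup_of_nonneg (norm_nonneg c) _).symm

theorem weightedSup_add_le (w : ι → ℝ) (hw : ∀ i, 0 < w i) {f g : ι → ℂ}
    (hf : f ∈ weightedBounded w hw) (hg : g ∈ weightedBounded w hw) :
    weightedSup w (f + g) ≤ weightedSup w f + weightedSup w g := by
  have nn : ∀ h : ι → ℂ, 0 ≤ weightedSup w h := fun h =>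
    Real.iSup_nonneg fun i => div_nonneg (norm_nonneg _) (hw i).le
  refine Real.iSup_le (fun i => ?_) (add_nonneg (nn f) (nn g))
  have h3 : ‖(f + g) i‖ / w i ≤ ‖f i‖ / w i + ‖g i‖ / w i := by
    rw [← add_div]
    exact div_le_div_of_nonneg_right (norm_add_le _ _) (hw i).le
  exact h3.trans (add_le_add (le_ciSup hf i) (le_ciSup hg i))

theorem eq_zero_of_weightedSup_eq_zero (w : ι → ℝ) (hw : ∀ i, 0 < w i) {f : ι → ℂ}
    (hf : f ∈ weightedBounded w hw) (h : weightedSup w f = 0) : f = 0 := by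
  funext i
  have h1 : ‖f i‖ / w i ≤ 0 := h ▸ le_ciSup hf i
  have h2 : ‖f i‖ ≤ 0 := by
    have := (div_le_iff₀ (hw i)).1 h1
    simpa using this
  simpa using h2

end WeightedSup

/-! ### The Fréchet space of sequences -/

/-- The indices `(r, x)`, `r, x > 0`, of the seminorms of the sequence space. -/
abbrev SeqIndex : Type := Set.Ioi (0 : ℝ) × Set.Ioi (0 : ℝ)

/-- The weight `k ↦ r^k M^(x)_k`. -/
def seqWeight (M : WeightMatrix) (p : SeqIndex) (k : ℕ) : ℝ := (p.1 : ℝ) ^ k * M.seq p.2 k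

theorem seqWeight_pos (M : WeightMatrix) (p : SeqIndex) (k : ℕ) : 0 < seqWeight M p k :=
  mul_pos (pow_pos p.1.2 k) ((M.seq p.2).pos k)

/-- The vector space `Λ^(𝔐)` of all complex sequences `a` with
`sup_k |a_k| / (r^k M^(x)_k) < ∞` for all `r, x > 0`. -/
def SeqSpace (M : WeightMatrix) : Type :=
  (⨅ p : SeqIndex, weightedBounded (seqWeight M p) (seqWeight_pos M p) : Submodule ℂ (ℕ → ℂ))

namespace SeqSpace

variable (M : WeightMatrix)

instance : AddCommGroup (SeqSpace M) :=
  inferInstanceAs (AddCommGroup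
    (⨅ p : SeqIndex, weightedBounded (seqWeight M p) (seqWeight_pos M p) : Submodule ℂ (ℕ → ℂ)))

instance : Module ℂ (SeqSpace M) :=
  inferInstanceAs (Module ℂ
    (⨅ p : SeqIndex, weightedBounded (seqWeight M p) (seqWeight_pos M p) : Submodule ℂ (ℕ → ℂ)))

instance : CoeFun (SeqSpace M) fun _ => ℕ → ℂ := ⟨fun a => a.1⟩

/-- The seminorms `‖a‖_{r,x} = sup_k |a_k| / (r^k M^(x)_k)`. -/
noncomputable def seminorms : SeminormFamily ℂ (SeqSpace M) SeqIndex := fun p =>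
  Seminorm.of (fun a => weightedSup (seqWeight M p) a)
    (fun a b => weightedSup_add_le _ (seqWeight_pos M p)
      ((Submodule.mem_iInf _).1 a.2 p) ((Submodule.mem_iInf _).1 b.2 p))
    (fun c a => weightedSup_smul _ c a)

/-- The locally convex topology generated by all the seminorms `‖·‖_{r,x}`. -/
noncomputable instance : TopologicalSpace (SeqSpace M) := (seminorms M).moduleFilterBasis.topology

theorem withSeminorms : WithSeminorms (seminorms M) := ⟨rfl⟩

instance : IsTopologicalAddGroup (SeqSpace M) := (withSeminorms M).topologicalAddGroup

instance : ContinuousSMul ℂ (SeqSpace M) := (withSeminorms M).continuousSMul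

/-- The `j`-th unit vector. -/
noncomputable def unit (j : ℕ) : SeqSpace M :=
  ⟨Pi.single j 1, (Submodule.mem_iInf _).2 fun p => by
    refine ⟨1 / seqWeight M p j, ?_⟩
    rintro _ ⟨k, rfl⟩
    by_cases h : k = j
    · subst h; simp
    · simpa [Pi.single_eq_of_ne h] using (seqWeight_pos M p j).le⟩

end SeqSpace

/-! ### Weighted spaces of entire functions -/

theorem expWeight_pos (g : ℂ → ℝ) (z : ℂ) : 0 < Real.exp (g z) := Real.exp_pos _

/-- The entire functions, as a vector space. -/
def entire : Submodule ℂ (ℂ → ℂ) where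
  carrier := {f | Differentiable ℂ f}
  zero_mem' := differentiable_const 0
  add_mem' := fun hf hg => Differentiable.add hf hg
  smul_mem' := fun c _ hf => Differentiable.const_smul hf c

/-- The vector space of all entire `f` with `sup_z |f z| / e^(g z) < ∞`. -/
noncomputable def entireStep (g : ℂ → ℝ) : Submodule ℂ (ℂ → ℂ) :=
  entire ⊓ weightedBounded (fun z => Real.exp (g z)) (expWeight_pos g)

/-- The space `A_g` of all entire `f` with `‖f‖ = sup_z |f z| / e^(g z) < ∞`, as a normed space. -/
def EntireStep (g : ℂ → ℝ) : Type := entireStep g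

namespace EntireStep

variable (g : ℂ → ℝ)

noncomputable instance : AddCommGroup (EntireStep g) := inferInstanceAs (AddCommGroup (entireStep g))

noncomputable instance : Module ℂ (EntireStep g) := inferInstanceAs (Module ℂ (entireStep g))

noncomputable instance : NormedAddCommGroup (EntireStep g) :=
  AddGroupNorm.toNormedAddCommGroup
    { toFun := fun f : EntireStep g => weightedSup (fun z => Real.exp (g z)) f.1
      map_zero' := weightedSup_zero _
      add_le' := fun f h => weightedSup_add_le _ (expWeight_pos g) f.2.2 h.2.2
      neg' := fun f => weightedSup_neg _ f.1
      eq_zero_of_map_eq_zero' := fun f h =>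
        Subtype.ext (eq_zero_of_weightedSup_eq_zero _ (expWeight_pos g) f.2.2 h) }

noncomputable instance : NormedSpace ℂ (EntireStep g) where
  norm_smul_le c f := (weightedSup_smul _ c f.1).le

end EntireStep

theorem entireStep_mono {g h : ℂ → ℝ} (hgh : ∀ z, g z ≤ h z) : entireStep g ≤ entireStep h := by
  rintro f ⟨hf, a, ha⟩
  refine ⟨hf, a, ?_⟩
  rintro _ ⟨z, rfl⟩
  exact (div_le_div_of_nonneg_left (norm_nonneg _) (Real.exp_pos _)
    (Real.exp_le_exp.2 (hgh z))).trans (ha ⟨z, rfl⟩)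

/-- The union `⋃_k A_(g_k)` for an increasing sequence `(g_k)`, as a vector space. -/
def entireUnion (G : ℕ → ℂ → ℝ) (hG : Monotone G) : Submodule ℂ (ℂ → ℂ) where
  carrier := {f | ∃ k, f ∈ entireStep (G k)}
  zero_mem' := ⟨0, Submodule.zero_mem _⟩
  add_mem' := by
    rintro f h ⟨k, hk⟩ ⟨l, hl⟩
    exact ⟨max k l, Submodule.add_mem _
      (entireStep_mono (hG (le_max_left k l)) hk) (entireStep_mono (hG (le_max_right k l)) hl)⟩
  smul_mem' := by
    rintro c f ⟨k, hk⟩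
    exact ⟨k, Submodule.smul_mem _ c hk⟩

/-- The space `⋃_k A_(g_k)`, to be endowed with the inductive limit topology. -/
def EntireLimit (G : ℕ → ℂ → ℝ) (hG : Monotone G) : Type := entireUnion G hG

namespace EntireLimit

variable (G : ℕ → ℂ → ℝ) (hG : Monotone G)

instance : AddCommGroup (EntireLimit G hG) := inferInstanceAs (AddCommGroup (entireUnion G hG))

instance : Module ℂ (EntireLimit G hG) := inferInstanceAs (Module ℂ (entireUnion G hG))

instance : CoeFun (EntireLimit G hG) fun _ => ℂ → ℂ := ⟨fun f => f.1⟩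

/-- The inclusion of the step `A_(g_k)`. -/
def incl (k : ℕ) (f : EntireStep (G k)) : EntireLimit G hG := ⟨f.1, k, f.2⟩

/-- The locally convex inductive limit topology: the finest locally convex vector space topology
for which the inclusions of all the normed spaces `A_(g_k)` are continuous. (In Mathlib's order of
topologies, the finest one is the smallest.) -/
instance : TopologicalSpace (EntireLimit G hG) :=
  sInf {t : TopologicalSpace (EntireLimit G hG) |
    @IsTopologicalAddGroup (EntireLimit G hG) t _ ∧
    @ContinuousSMul ℂ (EntireLimit G hG) _ _ t ∧
    @LocallyConvexSpace ℝ (EntireLimit G hG) _ _ _ _ t ∧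
    ∀ k, @Continuous _ _ _ t (incl G hG k)}

end EntireLimit

/-! ### The weights `z ↦ ω_{M^(1/k)}(k |z|)`, `k ≥ 1` -/

/-- The index `1 / (k + 1) > 0`. -/
noncomputable def recip (k : ℕ) : Set.Ioi (0 : ℝ) :=
  ⟨1 / ((k : ℝ) + 1), Set.mem_Ioi.2 (by positivity)⟩

/-- The sequence `Ω_𝔐` of the functions `z ↦ ω_{M^(1/k)}(k |z|)`, `k = 1, 2, …`; the natural
number `k` below stands for `k + 1`. -/
noncomputable def omegaSeq (M : WeightMatrix) (k : ℕ) (z : ℂ) : ℝ :=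
  assocWeight (M.seq (recip k)) (((k : ℝ) + 1) * ‖z‖)

theorem omegaSeq_mono (M : WeightMatrix) : Monotone (omegaSeq M) := by
  intro k l hkl z
  have hkl' : (k : ℝ) ≤ l := Nat.cast_le.2 hkl
  have hl : (0 : ℝ) ≤ ((l : ℝ) + 1) * ‖z‖ := by positivity
  refine ciSup_le fun j => le_trans ?_ (le_ciSup (bddAbove_assocWeight (M.seq (recip l)) hl) j)
  have hM : M.seq (recip l) j ≤ M.seq (recip k) j := by
    refine M.mono _ _ (Subtype.mk_le_mk.2 ?_) j
    exact one_div_le_one_div_of_le (by positivity) (by linarith)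
  rcases eq_or_lt_of_le (norm_nonneg z) with hz | hz
  · rcases Nat.eq_zero_or_pos j with rfl | hj
    · simp [(M.seq _).map_zero]
    · simp [← hz, hj.ne']
  · refine Real.log_le_log (div_pos (by positivity) ((M.seq _).pos j)) ?_
    exact div_le_div₀ (by positivity)
      (pow_le_pow_left₀ (by positivity) (by gcongr) j) ((M.seq _).pos j) hM

/-- The space `𝒜_{Ω_𝔐}` of the entire functions bounded by a multiple of `e^(ω_{M^(1/k)}(k |z|))`
for some `k ≥ 1`, with the inductive limit topology. -/
abbrev OmegaSpace (M : WeightMatrix) : Type := EntireLimit (omegaSeq M) (omegaSeq_mono M)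

end WeightMatrixDual

namespace WeightMatrixDual

/-! ### Estimates for the weights -/

/-! Write v_k(j) for `seqWeight M (diagIndex k) j`. Both spaces are described by the same
coefficient condition: |c_j| ≤ C / v_k(j) for some k and C.

For a functional T, c_j = T(e_j) satisfies it because finitely many seminorms control T
(`exists_coeff_bound`). For f in the k-th step, the Taylor coefficients satisfy it by Cauchy's
estimate on a circle where the supremum defining ω is attained at the index j
(`norm_taylorCoeff_le`). Conversely, v_{2k+1}(j) ≤ 2^(-j) v_k(j), so such c gives geometrically
convergent series ∑ c_j a_j and ∑ c_j z^j, at the price of passing from k to 2k+1. This yields the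
bijection.

Continuity of the inverse is tested on each step, where the functional of f is at most 2‖f‖ times
one seminorm. For the forward map, a continuous seminorm q on the limit yields the bounded set of
all 2^j s_j e_j, with s_j = q(z^j) + q(i z^j). If |T| ≤ δ there, then |T(e_j)| s_j ≤ δ 2^(-j), and
summation gives q(S T) ≤ 2δ. -/

theorem pow_div_le_exp_assocWeight (M : WeightSequence) {t : ℝ} (ht : 0 ≤ t) (j : ℕ) :
    t ^ j / M j ≤ Real.exp (assocWeight M t) := by
  rcases (div_nonneg (pow_nonneg ht j) (M.pos j).le).eq_or_lt with h | h
  · exact h ▸ (Real.exp_pos _).le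
  · rw [← Real.log_le_iff_le_exp h]
    exact le_ciSup (bddAbove_assocWeight M ht) j

/-- The sequence i ↦ t^i / M_i has successive ratios t / μ_(i+1). With t = μ_(j+1) and μ increasing,
they are ≥ 1 for i ≤ j and ≤ 1 for i ≥ j, so the maximum sits at j. -/
theorem pow_div_le_pow_div_quotient (M : WeightSequence) (j k : ℕ) :
    (M (j + 1) / M j) ^ k / M k ≤ (M (j + 1) / M j) ^ j / M j := by
  set t := M (j + 1) / M j with ht
  have ht0 : 0 < t := div_pos (M.pos _) (M.pos _)
  have key : ∀ i, t ^ (i + 1) / M (i + 1) = t ^ i / M i * (t / (M (i + 1) / M i)) := by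
    intro i
    have h1 := (M.pos i).ne'
    have h2 := (M.pos (i + 1)).ne'
    field_simp
    rw [pow_succ]
  have hq : ∀ i, 0 < M (i + 1) / M i := fun i => div_pos (M.pos _) (M.pos _)
  have hn : ∀ i, 0 ≤ t ^ i / M i := fun i => div_nonneg (pow_nonneg ht0.le i) (M.pos i).le
  rcases le_total j k with hjk | hkj
  · induction k, hjk using Nat.le_induction with
    | base => exact le_rfl
    | succ i hi ih =>
      rw [key]
      exact (mul_le_of_le_one_right (hn i) ((div_le_one (hq i)).2 (M.quotient_mono hi))).trans ih
  · induction hkj using Nat.decreasingInduction with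
    | self => exact le_rfl
    | of_succ i hi ih =>
      refine le_trans ?_ ih
      rw [key]
      exact le_mul_of_one_le_right (hn i) ((one_le_div (hq i)).2 (M.quotient_mono hi.le))

theorem exists_exp_assocWeight_le (M : WeightSequence) (j : ℕ) :
    ∃ t : ℝ, 0 < t ∧ Real.exp (assocWeight M t) ≤ t ^ j / M j := by
  have ht : 0 < M (j + 1) / M j := div_pos (M.pos _) (M.pos _)
  refine ⟨_, ht, ?_⟩
  rw [← Real.le_log_iff_exp_le (div_pos (pow_pos ht j) (M.pos j))]
  exact ciSup_le fun k => Real.log_le_log (div_pos (pow_pos ht k) (M.pos k))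
    (pow_div_le_pow_div_quotient M j k)

variable (M : WeightMatrix)

/-- The index `(1 / (k + 1), 1 / (k + 1))` of a cofinal sequence of seminorms. -/
noncomputable def diagIndex (k : ℕ) : SeqIndex := (recip k, recip k)

theorem seqWeight_diagIndex (k j : ℕ) :
    seqWeight M (diagIndex k) j = (1 / ((k : ℝ) + 1)) ^ j * M.seq (recip k) j := rfl

theorem norm_pow_le (k j : ℕ) (z : ℂ) :
    ‖z‖ ^ j ≤ seqWeight M (diagIndex k) j * Real.exp (omegaSeq M k z) := by
  have h := pow_div_le_exp_assocWeight (M.seq (recip k))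
    (t := ((k : ℝ) + 1) * ‖z‖) (by positivity) j
  have hk : (0 : ℝ) < (k : ℝ) + 1 := by positivity
  rw [div_le_iff₀ ((M.seq _).pos j), mul_pow] at h
  rw [seqWeight_diagIndex, div_pow, one_pow, div_mul_eq_mul_div, one_mul, div_mul_eq_mul_div,
    le_div_iff₀ (pow_pos hk j), mul_comm, mul_comm (M.seq _ j)]
  exact h

/-- Since (2k + 1) + 1 = 2(k + 1), the radius is halved exactly; this is the source of every
geometric factor below. -/
theorem seqWeight_diagIndex_double_le (k j : ℕ) :
    seqWeight M (diagIndex (2 * k + 1)) j ≤ (1 / 2) ^ j * seqWeight M (diagIndex k) j := by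
  rw [seqWeight_diagIndex, seqWeight_diagIndex, ← mul_assoc, ← mul_pow]
  have h : (1 : ℝ) / (((2 * k + 1 : ℕ) : ℝ) + 1) = 1 / 2 * (1 / ((k : ℝ) + 1)) := by
    push_cast
    field_simp
    ring
  rw [h]
  refine mul_le_mul_of_nonneg_left (M.mono _ _ (Subtype.mk_le_mk.2 ?_) j) (by positivity)
  exact one_div_le_one_div_of_le (by positivity) (by push_cast; linarith [k.cast_nonneg (α := ℝ)])

theorem eventually_seqWeight_diagIndex_le (p : SeqIndex) :
    ∀ᶠ k in atTop, ∀ j, seqWeight M (diagIndex k) j ≤ seqWeight M p j := by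
  have h := tendsto_one_div_add_atTop_nhds_zero_nat (𝕜 := ℝ)
  filter_upwards [h.eventually_le_const p.1.2, h.eventually_le_const p.2.2] with k h1 h2 j
  exact mul_le_mul (pow_le_pow_left₀ (by positivity) h1 j) (M.mono _ _ h2 j)
    ((M.seq _).pos j).le (pow_nonneg p.1.2.out.le j)

/-! ### Weighted norms -/

namespace EntireStep

variable {g : ℂ → ℝ}

theorem norm_apply_le (f : EntireStep g) (z : ℂ) : ‖f.1 z‖ ≤ ‖f‖ * Real.exp (g z) :=
  (div_le_iff₀ (Real.exp_pos _)).1 (le_ciSup f.2.2 z)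

theorem norm_le_of_forall {f : EntireStep g} {C : ℝ} (h : ∀ z, ‖f.1 z‖ ≤ C * Real.exp (g z)) :
    ‖f‖ ≤ C :=
  ciSup_le fun z => (div_le_iff₀ (Real.exp_pos _)).2 (h z)

/-- An entire function with a weighted bound, as an element of the step. -/
def mk {f : ℂ → ℂ} (hf : Differentiable ℂ f) {C : ℝ} (h : ∀ z, ‖f z‖ ≤ C * Real.exp (g z)) :
    EntireStep g :=
  ⟨f, hf, C, by
    rintro _ ⟨z, rfl⟩
    exact (div_le_iff₀ (Real.exp_pos _)).2 (h z)⟩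

end EntireStep

namespace SeqSpace

variable {M}

theorem norm_apply_le (p : SeqIndex) (a : SeqSpace M) (j : ℕ) :
    ‖a j‖ ≤ seminorms M p a * seqWeight M p j :=
  (div_le_iff₀ (seqWeight_pos M p j)).1 (le_ciSup ((Submodule.mem_iInf _).1 a.2 p) j)

theorem seminorms_le_of_forall {p : SeqIndex} {a : SeqSpace M} {C : ℝ}
    (h : ∀ j, ‖a j‖ ≤ C * seqWeight M p j) : seminorms M p a ≤ C :=
  ciSup_le fun j => (div_le_iff₀ (seqWeight_pos M p j)).2 (h j)

theorem smul_apply (c : ℂ) (a : SeqSpace M) (j : ℕ) : (c • a) j = c * a j := rfl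

theorem unit_apply_self (j : ℕ) : unit M j j = 1 := Pi.single_eq_same _ _

theorem unit_apply_of_ne {i j : ℕ} (h : i ≠ j) : unit M j i = 0 := Pi.single_eq_of_ne h _

theorem seminorms_unit_le (p : SeqIndex) (j : ℕ) :
    seminorms M p (unit M j) ≤ 1 / seqWeight M p j := by
  refine seminorms_le_of_forall fun i => ?_
  rcases eq_or_ne i j with rfl | h
  · rw [unit_apply_self, norm_one, one_div_mul_cancel (seqWeight_pos M p i).ne']
  · rw [unit_apply_of_ne h, norm_zero]
    exact mul_nonneg (one_div_nonneg.2 (seqWeight_pos M p j).le) (seqWeight_pos M p i).le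

theorem sum_smul_unit_apply (a : SeqSpace M) (s : Finset ℕ) (i : ℕ) :
    (∑ j ∈ s, a j • unit M j) i = if i ∈ s then a i else 0 := by
  classical
  induction s using Finset.induction_on with
  | empty => rfl
  | insert j s hj ih =>
    rw [Finset.sum_insert hj]
    change (a j • unit M j) i + (∑ j ∈ s, a j • unit M j) i = _
    rw [ih, smul_apply]
    rcases eq_or_ne i j with rfl | h
    · simp [unit_apply_self, hj]
    · simp [unit_apply_of_ne h, h]

theorem sub_apply (a b : SeqSpace M) (i : ℕ) : (a - b) i = a i - b i := rfl

/-- Halving the first component of the index. -/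
noncomputable def halfIndex (p : SeqIndex) : SeqIndex :=
  (⟨p.1 / 2, Set.mem_Ioi.2 (half_pos p.1.2)⟩, p.2)

theorem seqWeight_halfIndex (p : SeqIndex) (j : ℕ) :
    seqWeight M (halfIndex p) j = (1 / 2) ^ j * seqWeight M p j := by
  simp only [seqWeight, halfIndex]
  rw [div_eq_mul_one_div, mul_pow]
  ring

/-- Measured with radius r instead of r / 2, the tail from n on gains a factor 2^(-n). Hence a
functional is determined by its values on unit vectors. -/
theorem tendsto_sum_smul_unit (a : SeqSpace M) :
    Tendsto (fun n => ∑ j ∈ Finset.range n, a j • unit M j) atTop (𝓝 a) := by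
  rw [(withSeminorms M).tendsto_nhds]
  intro p ε hε
  have h0 : 0 ≤ seminorms M (halfIndex p) a := apply_nonneg _ _
  have hlim : Tendsto (fun n : ℕ => seminorms M (halfIndex p) a * (1 / 2 : ℝ) ^ n) atTop (𝓝 0) := by
    simpa using (tendsto_pow_atTop_nhds_zero_of_lt_one (r := (1 / 2 : ℝ)) (by norm_num)
      (by norm_num)).const_mul (seminorms M (halfIndex p) a)
  filter_upwards [hlim.eventually_lt_const hε] with n hn
  refine lt_of_le_of_lt (seminorms_le_of_forall fun i => ?_) hn
  rw [sub_apply, sum_smul_unit_apply]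
  have hw := (seqWeight_pos M p i).le
  split_ifs with hi
  · simpa using by positivity
  · rw [zero_sub, norm_neg, mul_assoc]
    refine (norm_apply_le (halfIndex p) a i).trans (mul_le_mul_of_nonneg_left ?_ h0)
    rw [seqWeight_halfIndex]
    refine mul_le_mul_of_nonneg_right ?_ hw
    exact pow_le_pow_of_le_one (by norm_num) (by norm_num) (by simpa using hi)

end SeqSpace

/-! ### Taylor coefficients -/

/-- The `j`-th Taylor coefficient at the origin. -/
noncomputable def taylorCoeff (f : ℂ → ℂ) (j : ℕ) : ℂ := (j.factorial : ℂ)⁻¹ * iteratedDeriv j f 0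

theorem hasSum_taylorCoeff {f : ℂ → ℂ} (hf : Differentiable ℂ f) (z : ℂ) :
    HasSum (fun j => taylorCoeff f j * z ^ j) (f z) := by
  refine (Complex.hasSum_taylorSeries_of_entire hf 0 z).congr_fun fun j => ?_
  simp only [taylorCoeff, smul_eq_mul, sub_zero]
  ring

variable {M}

theorem norm_taylorCoeff_le {k : ℕ} (f : EntireStep (omegaSeq M k)) (j : ℕ) :
    ‖taylorCoeff f.1 j‖ ≤ ‖f‖ / seqWeight M (diagIndex k) j := by
  obtain ⟨t, ht, hle⟩ := exists_exp_assocWeight_le (M.seq (recip k)) j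
  have hk : (0 : ℝ) < (k : ℝ) + 1 := by positivity
  have hf : Differentiable ℂ f.1 := f.2.1
  have hM := (M.seq (recip k)).pos j
  -- The circle has radius t / (k + 1), so that the weight on it is ω evaluated at t.
  have h := Complex.norm_iteratedDeriv_le_of_forall_mem_sphere_norm_le
    (C := ‖f‖ * (t ^ j / M.seq (recip k) j)) j (div_pos ht hk) hf.diffContOnCl
    (c := 0) fun z hz => by
      refine (f.norm_apply_le z).trans (mul_le_mul_of_nonneg_left ?_ (norm_nonneg _))
      rw [mem_sphere_zero_iff_norm] at hz
      rwa [omegaSeq, hz, mul_div_cancel₀ _ hk.ne']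
  rw [taylorCoeff, norm_mul, norm_inv, Complex.norm_natCast, inv_mul_le_iff₀ (by positivity)]
  refine h.trans_eq ?_
  rw [seqWeight_diagIndex, div_pow, div_pow, one_pow]
  field_simp

/-- Two everywhere convergent power series with the same sum have the same coefficients. -/
theorem eq_of_hasSum_pow {c d : ℕ → ℂ} {f : ℂ → ℂ} (hc : ∀ z, HasSum (fun j => c j * z ^ j) (f z))
    (hd : ∀ z, HasSum (fun j => d j * z ^ j) (f z)) : c = d := by
  have h : HasFPowerSeriesAt (0 : ℂ → ℂ) (FormalMultilinearSeries.ofScalars ℂ (c - d)) 0 := by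
    rw [hasFPowerSeriesAt_iff]
    refine Eventually.of_forall fun z => ?_
    have hz := (hc z).sub (hd z)
    rw [sub_self] at hz
    refine hz.congr_fun fun j => ?_
    rw [FormalMultilinearSeries.coeff_ofScalars, Pi.sub_apply, smul_eq_mul]
    ring
  funext j
  have hj : FormalMultilinearSeries.coeff (FormalMultilinearSeries.ofScalars ℂ (c - d)) j = 0 := by
    rw [h.eq_zero]; rfl
  rwa [FormalMultilinearSeries.coeff_ofScalars, Pi.sub_apply, sub_eq_zero] at hj

/-! ### Power series in the steps -/

namespace EntireStep

/-- Evaluation at a point. -/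
def evalₗ (g : ℂ → ℝ) (z : ℂ) : EntireStep g →ₗ[ℂ] ℂ where
  toFun f := f.1 z
  map_add' _ _ := rfl
  map_smul' _ _ := rfl

end EntireStep

variable (M) in
/-- The monomial `z ^ j` in the `k`-th step. -/
noncomputable def monomialStep (k j : ℕ) : EntireStep (omegaSeq M k) :=
  EntireStep.mk (f := fun z => z ^ j) (differentiable_pow j) fun z => by
    rw [norm_pow]; exact norm_pow_le M k j z

theorem norm_monomialStep_le (k j : ℕ) : ‖monomialStep M k j‖ ≤ seqWeight M (diagIndex k) j :=
  EntireStep.norm_le_of_forall fun z => (norm_pow z j).le.trans (norm_pow_le M k j z)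

theorem nonneg_of_coeff_bound {k : ℕ} {C : ℝ} {c : ℕ → ℂ}
    (hc : ∀ j, ‖c j‖ ≤ C / seqWeight M (diagIndex k) j) : 0 ≤ C := by
  have h := mul_nonneg ((norm_nonneg _).trans (hc 0)) (seqWeight_pos M (diagIndex k) 0).le
  rwa [div_mul_cancel₀ _ (seqWeight_pos M _ 0).ne'] at h

/-- The common estimate behind both series: it is applied with w = z^j and with w = a_j. -/
theorem norm_coeff_mul_le {k : ℕ} {C : ℝ} {c : ℕ → ℂ}
    (hc : ∀ j, ‖c j‖ ≤ C / seqWeight M (diagIndex k) j) {w : ℂ} {A : ℝ} (hA : 0 ≤ A) (j : ℕ)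
    (hw : ‖w‖ ≤ A * seqWeight M (diagIndex (2 * k + 1)) j) :
    ‖c j * w‖ ≤ C * A * (1 / 2) ^ j := by
  have hC := nonneg_of_coeff_bound hc
  have hv := seqWeight_pos M (diagIndex k) j
  rw [norm_mul]
  calc ‖c j‖ * ‖w‖ ≤ C / seqWeight M (diagIndex k) j *
        (A * ((1 / 2) ^ j * seqWeight M (diagIndex k) j)) :=
        mul_le_mul (hc j) (hw.trans (mul_le_mul_of_nonneg_left
          (seqWeight_diagIndex_double_le M k j) hA)) (norm_nonneg _) (div_nonneg hC hv.le)
    _ = C * A * (1 / 2) ^ j := by field_simp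

theorem norm_coeff_mul_pow_le {k : ℕ} {C : ℝ} {c : ℕ → ℂ}
    (hc : ∀ j, ‖c j‖ ≤ C / seqWeight M (diagIndex k) j) (z : ℂ) (j : ℕ) :
    ‖c j * z ^ j‖ ≤ C * Real.exp (omegaSeq M (2 * k + 1) z) * (1 / 2) ^ j := by
  refine norm_coeff_mul_le hc (Real.exp_pos _).le j ?_
  rw [norm_pow, mul_comm]
  exact norm_pow_le M _ j z

theorem summable_coeff_mul_pow {k : ℕ} {C : ℝ} {c : ℕ → ℂ}
    (hc : ∀ j, ‖c j‖ ≤ C / seqWeight M (diagIndex k) j) (z : ℂ) :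
    Summable fun j => c j * z ^ j :=
  .of_norm_bounded (summable_geometric_two.mul_left _) (norm_coeff_mul_pow_le hc z)

theorem differentiable_tsum_coeff {k : ℕ} {C : ℝ} {c : ℕ → ℂ}
    (hc : ∀ j, ‖c j‖ ≤ C / seqWeight M (diagIndex k) j) :
    Differentiable ℂ fun z => ∑' j, c j * z ^ j := by
  intro z
  set R : ℝ := ‖z‖ + 1
  have hR : 0 ≤ R := by positivity
  have h := Complex.differentiableOn_tsum_of_summable_norm (F := fun j z => c j * z ^ j)
    (U := Metric.ball 0 R) (summable_geometric_two.mul_left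
      (C * Real.exp (omegaSeq M (2 * k + 1) R)))
    (fun j => ((differentiable_pow j).const_mul (c j)).differentiableOn) Metric.isOpen_ball
    fun j w hw => by
      -- On the ball each term is dominated by its value at the real point R, so the majorant does
      -- not depend on w.
      refine le_trans ?_ (norm_coeff_mul_pow_le hc R j)
      rw [mem_ball_zero_iff] at hw
      rw [norm_mul, norm_mul, norm_pow, norm_pow, Complex.norm_real, Real.norm_of_nonneg hR]
      gcongr
  exact h.differentiableAt (Metric.isOpen_ball.mem_nhds (by simp [R]))

theorem norm_tsum_sub_sum_le {k : ℕ} {C : ℝ} {c : ℕ → ℂ}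
    (hc : ∀ j, ‖c j‖ ≤ C / seqWeight M (diagIndex k) j) (n : ℕ) (z : ℂ) :
    ‖∑' j, c j * z ^ j - ∑ j ∈ Finset.range n, c j * z ^ j‖ ≤
      2 * C * (1 / 2) ^ n * Real.exp (omegaSeq M (2 * k + 1) z) := by
  rw [← (summable_coeff_mul_pow hc z).sum_add_tsum_nat_add n, add_sub_cancel_left]
  have h := hasSum_geometric_two.mul_left
    (C * Real.exp (omegaSeq M (2 * k + 1) z) * (1 / 2) ^ n)
  refine (tsum_of_norm_bounded h fun j => ?_).trans_eq (by ring)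
  refine (norm_coeff_mul_pow_le hc z (j + n)).trans_eq ?_
  rw [pow_add]
  ring

/-- The sum of a power series, as an element of a step. -/
noncomputable def powerSeriesStep {k : ℕ} {C : ℝ} {c : ℕ → ℂ}
    (hc : ∀ j, ‖c j‖ ≤ C / seqWeight M (diagIndex k) j) :
    EntireStep (omegaSeq M (2 * k + 1)) :=
  EntireStep.mk (differentiable_tsum_coeff hc) (C := 2 * C) fun z => by
    simpa using norm_tsum_sub_sum_le hc 0 z

theorem norm_powerSeriesStep_sub_le {k : ℕ} {C : ℝ} {c : ℕ → ℂ}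
    (hc : ∀ j, ‖c j‖ ≤ C / seqWeight M (diagIndex k) j) (n : ℕ) :
    ‖powerSeriesStep hc - ∑ j ∈ Finset.range n, c j • monomialStep M (2 * k + 1) j‖ ≤
      2 * C * (1 / 2) ^ n := by
  refine EntireStep.norm_le_of_forall fun z => ?_
  refine le_trans (le_of_eq ?_) (norm_tsum_sub_sum_le hc n z)
  congr 1
  refine (map_sub (EntireStep.evalₗ (omegaSeq M (2 * k + 1)) z) _ _).trans ?_
  rw [map_sum]
  rfl

/-! ### The topology of the inductive limit -/

namespace EntireLimit

variable (G : ℕ → ℂ → ℝ) (hG : Monotone G)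

instance : IsTopologicalAddGroup (EntireLimit G hG) := topologicalAddGroup_sInf fun _ ht => ht.1

instance : ContinuousSMul ℂ (EntireLimit G hG) := continuousSMul_sInf fun _ ht => ht.2.1

instance : LocallyConvexSpace ℝ (EntireLimit G hG) := LocallyConvexSpace.sInf fun _ ht => ht.2.2.1

/-- The inclusion of a step, as a continuous linear map. -/
def inclL (k : ℕ) : EntireStep (G k) →L[ℂ] EntireLimit G hG where
  toFun := incl G hG k
  map_add' _ _ := rfl
  map_smul' _ _ := rfl
  cont := continuous_sInf_rng.2 fun _ ht => ht.2.2.2 k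

/-- The universal property of the locally convex inductive limit. -/
theorem continuous_of_comp_inclL {F : Type*} [AddCommGroup F] [Module ℂ F] [Module ℝ F]
    [IsScalarTower ℝ ℂ F] [TopologicalSpace F] [IsTopologicalAddGroup F] [ContinuousSMul ℂ F]
    [LocallyConvexSpace ℝ F] (φ : EntireLimit G hG →ₗ[ℂ] F)
    (h : ∀ k, Continuous fun f => φ (inclL G hG k f)) : Continuous φ := by
  rw [continuous_iff_le_induced]
  refine sInf_le ⟨topologicalAddGroup_induced φ, continuousSMul_induced φ,
    LocallyConvexSpace.induced (φ.restrictScalars ℝ), fun k => ?_⟩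
  exact continuous_induced_rng.2 (h k)

end EntireLimit

/-! ### Functionals on the sequence space -/

theorem exists_coeff_bound (T : StrongDual ℂ (SeqSpace M)) :
    ∃ (k : ℕ) (C : ℝ), ∀ j, ‖T (SeqSpace.unit M j)‖ ≤ C / seqWeight M (diagIndex k) j := by
  obtain ⟨s, C, -, hC⟩ := Seminorm.bound_of_continuous (SeqSpace.withSeminorms M)
    ((normSeminorm ℂ ℂ).comp T.toLinearMap) T.continuous.norm
  -- One diagonal weight lies below the finitely many weights in s, and the seminorm of e_j is at
  -- most the reciprocal weight.
  obtain ⟨k, hk⟩ := ((Finset.eventually_all s).2 fun p _ =>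
    eventually_seqWeight_diagIndex_le M p).exists
  refine ⟨k, C, fun j => (hC (SeqSpace.unit M j)).trans ?_⟩
  have hv := seqWeight_pos M (diagIndex k) j
  rw [div_eq_mul_one_div]
  refine mul_le_mul_of_nonneg_left ?_ C.2
  refine Seminorm.finset_sup_apply_le (one_div_nonneg.2 hv.le) fun p hp => ?_
  exact (SeqSpace.seminorms_unit_le p j).trans (one_div_le_one_div_of_le hv (hk p hp j))

theorem norm_coeff_mul_apply_le {k : ℕ} {C : ℝ} {c : ℕ → ℂ}
    (hc : ∀ j, ‖c j‖ ≤ C / seqWeight M (diagIndex k) j) (a : SeqSpace M) (j : ℕ) :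
    ‖c j * a j‖ ≤ C * SeqSpace.seminorms M (diagIndex (2 * k + 1)) a * (1 / 2) ^ j :=
  norm_coeff_mul_le hc (apply_nonneg _ _) j (SeqSpace.norm_apply_le _ a j)

theorem summable_coeff_mul_apply {k : ℕ} {C : ℝ} {c : ℕ → ℂ}
    (hc : ∀ j, ‖c j‖ ≤ C / seqWeight M (diagIndex k) j) (a : SeqSpace M) :
    Summable fun j => c j * a j :=
  .of_norm_bounded (summable_geometric_two.mul_left _) (norm_coeff_mul_apply_le hc a)

theorem norm_tsum_coeff_mul_apply_le {k : ℕ} {C : ℝ} {c : ℕ → ℂ}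
    (hc : ∀ j, ‖c j‖ ≤ C / seqWeight M (diagIndex k) j) (a : SeqSpace M) :
    ‖∑' j, c j * a j‖ ≤ 2 * C * SeqSpace.seminorms M (diagIndex (2 * k + 1)) a :=
  (tsum_of_norm_bounded (hasSum_geometric_two.mul_left _)
    (norm_coeff_mul_apply_le hc a)).trans_eq (by ring)

/-- The linear form `a ↦ ∑ c_j a_j`. -/
noncomputable def coeffLinearForm {k : ℕ} {C : ℝ} {c : ℕ → ℂ}
    (hc : ∀ j, ‖c j‖ ≤ C / seqWeight M (diagIndex k) j) : SeqSpace M →ₗ[ℂ] ℂ where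
  toFun a := ∑' j, c j * a j
  map_add' a b := by
    rw [← (summable_coeff_mul_apply hc a).tsum_add (summable_coeff_mul_apply hc b)]
    exact tsum_congr fun j => mul_add _ _ _
  map_smul' r a := by
    rw [RingHom.id_apply, smul_eq_mul, ← tsum_mul_left]
    exact tsum_congr fun j => mul_left_comm _ _ _

/-- The functional `a ↦ ∑ c_j a_j`. -/
noncomputable def coeffFunctional {k : ℕ} {C : ℝ} {c : ℕ → ℂ}
    (hc : ∀ j, ‖c j‖ ≤ C / seqWeight M (diagIndex k) j) : StrongDual ℂ (SeqSpace M) where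
  toLinearMap := coeffLinearForm hc
  cont := (SeqSpace.withSeminorms M).continuous_normedSpace_rng ℂ (coeffLinearForm hc)
    ⟨{diagIndex (2 * k + 1)}, ⟨2 * C, mul_nonneg zero_le_two (nonneg_of_coeff_bound hc)⟩,
      fun a => by
        rw [Finset.sup_singleton]
        exact norm_tsum_coeff_mul_apply_le hc a⟩

theorem coeffFunctional_apply {k : ℕ} {C : ℝ} {c : ℕ → ℂ}
    (hc : ∀ j, ‖c j‖ ≤ C / seqWeight M (diagIndex k) j) (a : SeqSpace M) :
    coeffFunctional hc a = ∑' j, c j * a j := rfl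

theorem coeffFunctional_unit {k : ℕ} {C : ℝ} {c : ℕ → ℂ}
    (hc : ∀ j, ‖c j‖ ≤ C / seqWeight M (diagIndex k) j) (j : ℕ) :
    coeffFunctional hc (SeqSpace.unit M j) = c j := by
  rw [coeffFunctional_apply, tsum_eq_single j fun i hi => by rw [SeqSpace.unit_apply_of_ne hi, mul_zero],
    SeqSpace.unit_apply_self, mul_one]

theorem functional_ext {T T' : StrongDual ℂ (SeqSpace M)}
    (h : ∀ j, T (SeqSpace.unit M j) = T' (SeqSpace.unit M j)) : T = T' := by
  ext a
  have ha := SeqSpace.tendsto_sum_smul_unit a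
  refine tendsto_nhds_unique ((T.continuous.tendsto a).comp ha) ?_
  refine ((T'.continuous.tendsto a).comp ha).congr fun n => ?_
  simp [h]

/-! ### The isomorphism -/

theorem hasSum_functional_unit (T : StrongDual ℂ (SeqSpace M)) (z : ℂ) :
    HasSum (fun j => T (SeqSpace.unit M j) * z ^ j) (∑' j, T (SeqSpace.unit M j) * z ^ j) := by
  obtain ⟨k, C, hc⟩ := exists_coeff_bound T
  exact (summable_coeff_mul_pow hc z).hasSum

variable (M) in
/-- The map `T ↦ ∑ T(e_j) z^j`. -/
noncomputable def generatingFunction : StrongDual ℂ (SeqSpace M) →ₗ[ℂ] OmegaSpace M where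
  toFun T := ⟨fun z => ∑' j, T (SeqSpace.unit M j) * z ^ j, by
    obtain ⟨k, C, hc⟩ := exists_coeff_bound T
    exact ⟨2 * k + 1, (powerSeriesStep hc).2⟩⟩
  map_add' T T' := Subtype.ext <| funext fun z =>
    ((hasSum_functional_unit T z).add (hasSum_functional_unit T' z)).tsum_eq ▸
      tsum_congr fun j => add_mul _ _ _
  map_smul' r T := Subtype.ext <| funext fun z => by
    change ∑' j, r * T (SeqSpace.unit M j) * z ^ j = r * ∑' j, T (SeqSpace.unit M j) * z ^ j
    rw [← tsum_mul_left]
    exact tsum_congr fun j => mul_assoc _ _ _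

theorem hasSum_generatingFunction (T : StrongDual ℂ (SeqSpace M)) (z : ℂ) :
    HasSum (fun j => T (SeqSpace.unit M j) * z ^ j) (generatingFunction M T z) :=
  hasSum_functional_unit T z

theorem generatingFunction_injective : Function.Injective (generatingFunction M) := by
  intro T T' h
  refine functional_ext fun j => congrFun (eq_of_hasSum_pow
    (c := fun j => T (SeqSpace.unit M j)) (d := fun j => T' (SeqSpace.unit M j))
    (hasSum_generatingFunction T) ?_) j
  rw [h]
  exact hasSum_generatingFunction T'

theorem generatingFunction_coeffFunctional {k : ℕ} (f : EntireStep (omegaSeq M k)) :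
    generatingFunction M (coeffFunctional (norm_taylorCoeff_le f)) =
      EntireLimit.inclL _ (omegaSeq_mono M) k f := by
  refine Subtype.ext (funext fun z => ?_)
  refine (hasSum_generatingFunction _ z).unique ?_
  simp only [coeffFunctional_unit]
  exact hasSum_taylorCoeff f.2.1 z

theorem generatingFunction_surjective : Function.Surjective (generatingFunction M) := by
  rintro ⟨f, k, hf⟩
  exact ⟨_, generatingFunction_coeffFunctional (⟨f, hf⟩ : EntireStep (omegaSeq M k))⟩

variable (M) in
/-- The map `T ↦ ∑ T(e_j) z^j`, as a linear equivalence. -/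
noncomputable def generatingEquiv : StrongDual ℂ (SeqSpace M) ≃ₗ[ℂ] OmegaSpace M :=
  .ofBijective (generatingFunction M)
    ⟨generatingFunction_injective, generatingFunction_surjective⟩

theorem generatingEquiv_symm_inclL {k : ℕ} (f : EntireStep (omegaSeq M k)) :
    (generatingEquiv M).symm (EntireLimit.inclL _ (omegaSeq_mono M) k f) =
      coeffFunctional (norm_taylorCoeff_le f) := by
  rw [LinearEquiv.symm_apply_eq]
  exact (generatingFunction_coeffFunctional f).symm

theorem continuous_generatingEquiv_symm : Continuous (generatingEquiv M).symm := by
  refine EntireLimit.continuous_of_comp_inclL _ _ (generatingEquiv M).symm.toLinearMap fun k => ?_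
  refine continuous_of_continuousAt_zero ((generatingEquiv M).symm.toLinearMap ∘ₗ
    (EntireLimit.inclL _ (omegaSeq_mono M) k).toLinearMap) ?_
  rw [ContinuousAt, map_zero, ContinuousLinearMap.hasBasis_nhds_zero.tendsto_right_iff]
  rintro ⟨B, V⟩ ⟨hB, hV⟩
  obtain ⟨R, hR, hBR⟩ := (SeqSpace.withSeminorms M).isVonNBounded_iff_seminorm_bounded.1 hB
    (diagIndex (2 * k + 1))
  obtain ⟨ε, hε, hVε⟩ := Metric.mem_nhds_iff.1 hV
  -- On B the functional of f is at most 2‖f‖R, hence the radius ε / (2R).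
  filter_upwards [Metric.ball_mem_nhds (0 : EntireStep (omegaSeq M k))
    (div_pos hε (mul_pos two_pos hR))] with f hf a ha
  refine hVε ?_
  rw [mem_ball_zero_iff] at hf ⊢
  change ‖(generatingEquiv M).symm (EntireLimit.inclL _ (omegaSeq_mono M) k f) a‖ < ε
  rw [generatingEquiv_symm_inclL, coeffFunctional_apply]
  refine (norm_tsum_coeff_mul_apply_le (norm_taylorCoeff_le f) a).trans_lt ?_
  rw [lt_div_iff₀ (mul_pos two_pos hR)] at hf
  refine lt_of_le_of_lt ?_ hf
  rw [mul_comm 2 ‖f‖, mul_assoc]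
  gcongr
  exact (hBR a ha).le

/-- Local convexity over ℝ provides seminorms that are only real-homogeneous; complex coefficients
are split into real and imaginary parts. -/
theorem seminorm_smul_le {E : Type*} [AddCommGroup E] [Module ℂ E] (q : Seminorm ℝ E) (c : ℂ)
    (x : E) : q (c • x) ≤ ‖c‖ * (q x + q (Complex.I • x)) := by
  have h : c • x = c.re • x + c.im • Complex.I • x := by
    conv_lhs => rw [← Complex.re_add_im c, add_smul, mul_smul]
    simp only [Complex.coe_smul]
  rw [h, mul_add]
  refine (map_add_le_add q _ _).trans (add_le_add ?_ ?_)
  · rw [map_smul_eq_mul]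
    exact mul_le_mul_of_nonneg_right (Complex.abs_re_le_norm c) (apply_nonneg _ _)
  · rw [map_smul_eq_mul]
    exact mul_le_mul_of_nonneg_right (Complex.abs_im_le_norm c) (apply_nonneg _ _)

variable (M) in
/-- The monomial `z ^ j` in the inductive limit. -/
noncomputable def monomial (j : ℕ) : OmegaSpace M :=
  EntireLimit.inclL _ (omegaSeq_mono M) 0 (monomialStep M 0 j)

theorem inclL_monomialStep (k j : ℕ) :
    EntireLimit.inclL _ (omegaSeq_mono M) k (monomialStep M k j) = monomial M j :=
  Subtype.ext (funext fun _ => rfl)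

theorem exists_seminorm_inclL_le {q : Seminorm ℝ (OmegaSpace M)} (hq : Continuous q) (k : ℕ) :
    ∃ D > 0, ∀ f, q (EntireLimit.inclL _ (omegaSeq_mono M) k f) ≤ D * ‖f‖ :=
  Seminorm.bound_of_continuous_normedSpace
    (q.comp ((EntireLimit.inclL _ (omegaSeq_mono M) k).toLinearMap.restrictScalars ℝ))
    (hq.comp (EntireLimit.inclL _ (omegaSeq_mono M) k).continuous)

/-- A real seminorm of a monomial and of its multiple by the imaginary unit. -/
noncomputable def monomialSize (q : Seminorm ℝ (OmegaSpace M)) (j : ℕ) : ℝ :=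
  q (monomial M j) + q (Complex.I • monomial M j)

theorem monomialSize_nonneg (q : Seminorm ℝ (OmegaSpace M)) (j : ℕ) : 0 ≤ monomialSize q j :=
  add_nonneg (apply_nonneg _ _) (apply_nonneg _ _)

/-- Continuity of q on every step makes its values on monomials O(v_k(j)) for each k. Choosing k for
half the radius of p leaves a spare 2^(-j), which absorbs the factor 2^j. -/
theorem isVonNBounded_range_monomialSize_smul_unit {q : Seminorm ℝ (OmegaSpace M)}
    (hq : Continuous q) :
    Bornology.IsVonNBounded ℂ (Set.range fun j : ℕ =>
      ((2 ^ j * monomialSize q j : ℝ) : ℂ) • SeqSpace.unit M j) := by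
  rw [(SeqSpace.withSeminorms M).isVonNBounded_iff_seminorm_bounded]
  intro p
  obtain ⟨k, hk⟩ := (eventually_seqWeight_diagIndex_le M (SeqSpace.halfIndex p)).exists
  obtain ⟨D, hD, hqD⟩ := exists_seminorm_inclL_le hq k
  -- The two summands of `monomialSize` give 2D; the 1 makes the inequality strict.
  refine ⟨2 * D + 1, by positivity, ?_⟩
  rintro _ ⟨j, rfl⟩
  have hp := seqWeight_pos M p j
  have hs := monomialSize_nonneg q j
  have hsize : monomialSize q j ≤ 2 * D * ((1 / 2) ^ j * seqWeight M p j) := by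
    have h1 : ‖monomialStep M k j‖ ≤ (1 / 2) ^ j * seqWeight M p j :=
      (norm_monomialStep_le k j).trans ((hk j).trans_eq (SeqSpace.seqWeight_halfIndex p j))
    have h2 := hqD (monomialStep M k j)
    have h3 := hqD (Complex.I • monomialStep M k j)
    rw [norm_smul, Complex.norm_I, one_mul, map_smul] at h3
    rw [inclL_monomialStep] at h2 h3
    have h4 := mul_le_mul_of_nonneg_left h1 hD.le
    rw [monomialSize]
    linarith
  have h2j : (2 : ℝ) ^ j * (1 / 2) ^ j = 1 := by rw [← mul_pow]; norm_num
  rw [map_smul_eq_mul, Complex.norm_real, Real.norm_of_nonneg (by positivity)]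
  refine lt_of_le_of_lt ?_ (lt_add_one (2 * D))
  calc 2 ^ j * monomialSize q j * SeqSpace.seminorms M p (SeqSpace.unit M j)
      ≤ 2 ^ j * (2 * D * ((1 / 2) ^ j * seqWeight M p j)) * (1 / seqWeight M p j) := by
        gcongr
        exact SeqSpace.seminorms_unit_le p j
    _ = 2 * D * (2 ^ j * (1 / 2) ^ j) := by field_simp
    _ = 2 * D := by rw [h2j, mul_one]

theorem generatingEquiv_eq_inclL {T : StrongDual ℂ (SeqSpace M)} {k : ℕ} {C : ℝ}
    (hc : ∀ j, ‖T (SeqSpace.unit M j)‖ ≤ C / seqWeight M (diagIndex k) j) :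
    generatingEquiv M T =
      EntireLimit.inclL _ (omegaSeq_mono M) (2 * k + 1) (powerSeriesStep hc) :=
  Subtype.ext (funext fun _ => rfl)

/-- The constants k, C, D depend on T, but they enter only through the remainder of the power
series, which tends to 0 in a single step. The bound that survives depends on δ alone. -/
theorem seminorm_generatingEquiv_le {q : Seminorm ℝ (OmegaSpace M)} (hq : Continuous q)
    {T : StrongDual ℂ (SeqSpace M)} {δ : ℝ}
    (hT : ∀ j, ‖T (SeqSpace.unit M j)‖ * monomialSize q j ≤ δ * (1 / 2) ^ j) :
    q (generatingEquiv M T) ≤ δ * 2 := by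
  obtain ⟨k, C, hc⟩ := exists_coeff_bound T
  obtain ⟨D, hD, hqD⟩ := exists_seminorm_inclL_le hq (2 * k + 1)
  have hδ : 0 ≤ δ := by
    simpa using (mul_nonneg (norm_nonneg _) (monomialSize_nonneg q 0)).trans (hT 0)
  have hlim : Tendsto (fun n : ℕ => δ * 2 + D * (2 * C * (1 / 2 : ℝ) ^ n)) atTop (𝓝 (δ * 2)) := by
    simpa using (((tendsto_pow_atTop_nhds_zero_of_lt_one (r := (1 / 2 : ℝ)) (by norm_num)
      (by norm_num)).const_mul (2 * C)).const_mul D).const_add (δ * 2)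
  refine ge_of_tendsto' hlim fun n => ?_
  have hsplit : generatingEquiv M T =
      ∑ j ∈ Finset.range n, T (SeqSpace.unit M j) • monomial M j +
        EntireLimit.inclL _ (omegaSeq_mono M) (2 * k + 1) (powerSeriesStep hc -
          ∑ j ∈ Finset.range n, T (SeqSpace.unit M j) • monomialStep M (2 * k + 1) j) := by
    rw [map_sub, map_sum]
    simp only [map_smul, inclL_monomialStep]
    rw [add_sub_cancel, generatingEquiv_eq_inclL hc]
  rw [hsplit]
  refine (map_add_le_add q _ _).trans (add_le_add ?_ ?_)
  · calc q (∑ j ∈ Finset.range n, T (SeqSpace.unit M j) • monomial M j)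
        ≤ ∑ j ∈ Finset.range n, q (T (SeqSpace.unit M j) • monomial M j) :=
          Finset.le_sum_of_subadditive q (map_zero q).le (map_add_le_add q) _ _
      _ ≤ ∑ j ∈ Finset.range n, δ * (1 / 2) ^ j :=
          Finset.sum_le_sum fun j _ => (seminorm_smul_le q _ _).trans (hT j)
      _ ≤ δ * 2 := sum_le_hasSum _ (fun j _ => by positivity) (hasSum_geometric_two.mul_left δ)
  · exact (hqD _).trans (mul_le_mul_of_nonneg_left (norm_powerSeriesStep_sub_le hc n) hD.le)

theorem continuous_generatingEquiv : Continuous (generatingEquiv M) := by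
  refine continuous_of_continuousAt_zero (generatingEquiv M) ?_
  have : ContinuousSMul ℝ (OmegaSpace M) := IsScalarTower.continuousSMul ℂ
  have hP := PolynormableSpace.withSeminorms ℝ (OmegaSpace M)
  rw [ContinuousAt, map_zero, hP.tendsto_nhds]
  rintro ⟨q, hq⟩ ε hε
  -- The geometric series costs a factor 2, and 2(ε / 3) < ε.
  have hmem := (ContinuousLinearMap.hasBasis_nhds_zero (σ := RingHom.id ℂ) (E := SeqSpace M)
    (F := ℂ)).mem_of_mem (i := (_, Metric.ball 0 (ε / 3)))
    ⟨isVonNBounded_range_monomialSize_smul_unit hq, Metric.ball_mem_nhds _ (by positivity)⟩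
  filter_upwards [hmem] with T hT
  rw [sub_zero]
  refine (seminorm_generatingEquiv_le hq (δ := ε / 3) fun j => ?_).trans_lt (by linarith)
  have h := hT _ ⟨j, rfl⟩
  have hs := monomialSize_nonneg q j
  rw [mem_ball_zero_iff, map_smul, smul_eq_mul, norm_mul, Complex.norm_real,
    Real.norm_of_nonneg (by positivity)] at h
  rw [one_div_pow, mul_one_div, le_div_iff₀ (by positivity)]
  linarith

end WeightMatrixDual

/-- The dual carries the topology of uniform convergence on (von Neumann) bounded sets. -/
theorem theorem4p8 (M : WeightMatrixDual.WeightMatrix) :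
    ∃ S : StrongDual ℂ (WeightMatrixDual.SeqSpace M) ≃L[ℂ] WeightMatrixDual.OmegaSpace M,
      ∀ (T : StrongDual ℂ (WeightMatrixDual.SeqSpace M)) (z : ℂ),
        HasSum (fun j : ℕ => T (WeightMatrixDual.SeqSpace.unit M j) * z ^ j) ((S T) z) :=
  ⟨{ WeightMatrixDual.generatingEquiv M with
      continuous_toFun := WeightMatrixDual.continuous_generatingEquiv
      continuous_invFun := WeightMatrixDual.continuous_generatingEquiv_symm },
    WeightMatrixDual.hasSum_generatingFunction⟩
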